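/- All groups are finite. For a finite group $G$, let $\Phi(G)$ be the Frattini subgroup, $F(G)$ the Fitting subgroup (the largest nilpotent normal subgroup), and $\mathrm{Soc}(G)$ the socle (the subgroup generated by all minimal normal subgroups of $G$). Let $F^*(G)$ be the quasinilpotent radical, that is, the subgroup containing $F(G)$ such that $F^*(G)/F(G)=\mathrm{Soc}\big(C_G(F(G))F(G)/F(G)\big)$. Let $\tilde F(G)$ be the subgroup containing $\Phi(G)$ such that $\tilde F(G)/\Phi(G)=\mathrm{Soc}(G/\Phi(G))$. A group $G$ is called quasinilpotent if every element of $G$ induces by conjugation an inner automorphism on every chief factor of $G$. Put $\tilde F^0(G)=G$ and $\tilde F^n(G)=\tilde F(\tilde F^{n-1}(G))$ for $n\ge 1$, and let $\tilde F^\infty(G)$ be the smallest subgroup in the descending series $G=\tilde F^0(G)\ge\tilde F^1(G)\ge\cdots$. **Corollary 3.4.** Let $N$ and $H$ be normal subgroups of a finite group $G$. Then: 1. $\tilde F^\infty(G)/\Phi(\tilde F^\infty(G))$ is quasinilpotent; 2. $F^*(G)\le\tilde F^\infty(G)\le\tilde F(G)$; 3. if $\Phi(\tilde F^\infty(G))=1$,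 then $\tilde F^\infty(G)=F^*(G)$; 4. $C_G(\tilde F^\infty(G))\le F(G)$; 5. $\tilde F^\infty(N)\le\tilde F^\infty(G)$; 6. $\tilde F^\infty(G)N/N\le\tilde F^\infty(G/N)$; 7. if $G=N\times H$ (internal direct product), then $\tilde F^\infty(G)=\tilde F^\infty(H)\times\tilde F^\infty(N)$. -/

import Mathlib

namespace GenFitting

/-- `N` is a minimal normal subgroup of `G`: minimal among the nontrivial normal subgroups. -/
def IsMinimalNormal {G : Type*} [Group G] (N : Subgroup G) : Prop :=
  Minimal (fun K : Subgroup G => K.Normal ∧ K ≠ ⊥) N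

/-- The socle `Soc(G)`: the subgroup generated by all minimal normal subgroups of `G`. -/
def socle (G : Type*) [Group G] : Subgroup G :=
  sSup {N : Subgroup G | IsMinimalNormal N}

/-- The Fitting subgroup `F(G)`: the subgroup generated by all nilpotent normal subgroups of `G`
(for finite `G` this is the largest nilpotent normal subgroup). -/
def fitting (G : Type*) [Group G] : Subgroup G :=
  sSup {N : Subgroup G | N.Normal ∧ Group.IsNilpotent N}

instance fitting_normal (G : Type*) [Group G] : (fitting G).Normal := by
  constructor
  intro x hx g
  have key : fitting G ≤ (fitting G).comap (MulAut.conj g).toMonoidHom := by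
    refine sSup_le ?_
    intro N hN y hy
    have hle : N ≤ fitting G := le_sSup hN
    exact hle (hN.1.conj_mem y hy g)
  exact key hx

/-- The quasinilpotent radical `F*(G)`: the subgroup containing `F(G)` that is determined by
`F*(G)/F(G) = Soc(C_G(F(G))F(G)/F(G))`. Here `C_G(F(G))F(G)/F(G)` is the image of `C_G(F(G))`
in `G/F(G)`, and the socle is the socle of that group. -/
def genFitting (G : Type*) [Group G] : Subgroup G :=
  ((socle ((Subgroup.centralizer (fitting G : Set G)).map (QuotientGroup.mk' (fitting G)))).map
    (Subgroup.subtype _)).comap (QuotientGroup.mk' (fitting G))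

/-- `H/K` is a chief factor of `G`: `K < H` are normal in `G` and no normal subgroup of `G` lies
strictly between them. -/
def IsChiefFactor {G : Type*} [Group G] (H K : Subgroup G) : Prop :=
  H.Normal ∧ K.Normal ∧ K < H ∧ ∀ L : Subgroup G, L.Normal → K ≤ L → L ≤ H → L = K ∨ L = H

/-- `G` is quasinilpotent: on every chief factor `H/K` of `G`, conjugation by any element `g` of
`G` agrees with conjugation by some element `h` of `H`, so that `g` induces an inner automorphism
of `H/K`. -/
def IsQuasinilpotent (G : Type*) [Group G] : Prop :=
  ∀ H K : Subgroup G, IsChiefFactor H K →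
    ∀ g : G, ∃ h ∈ H, ∀ x ∈ H, (h * x * h⁻¹)⁻¹ * (g * x * g⁻¹) ∈ K

/-- The subgroup `F̃(G)`, determined by `Φ(G) ≤ F̃(G)` and `F̃(G)/Φ(G) = Soc(G/Φ(G))`. -/
def tildeF (G : Type*) [Group G] : Subgroup G :=
  (socle (G ⧸ frattini G)).comap (QuotientGroup.mk' (frattini G))

/-- The series `F̃⁰(G) = G`, `F̃ⁿ⁺¹(G) = F̃(F̃ⁿ(G))`, as subgroups of `G`. -/
def tildeFSeries (G : Type*) [Group G] : ℕ → Subgroup G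
  | 0 => ⊤
  | n + 1 => (tildeF (tildeFSeries G n)).map (tildeFSeries G n).subtype

/-- The limit `F̃^∞(G)` of the descending series `F̃ⁿ(G)`, its smallest member for finite `G`. -/
def tildeFLim (G : Type*) [Group G] : Subgroup G :=
  ⨅ n : ℕ, tildeFSeries G n

/-- `K = A × B` as an internal direct product of subgroups of a common group. -/
def IsInternalDirectProduct {G : Type*} [Group G] (K A B : Subgroup G) : Prop :=
  A ⊔ B = K ∧ A ⊓ B = ⊥ ∧ ∀ a ∈ A, ∀ b ∈ B, a * b = b * a

end GenFitting

/-! Everything rests on one description: `tildeFLim G` is the largest normal subgroup `M` with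
`tildeF M = ⊤`, that is, with `M/Φ(M)` equal to its own socle (`tildeF_tildeFLim`, `le_tildeFLim`).
This property passes to quotients, which settles normal subgroups, quotients and direct products. A
group equal to its socle is quasinilpotent because its normal subgroups have normal complements.

Maximality needs `le_tildeF`: modulo `Φ(G)` such an `M` is its own socle, and
`le_socle_of_socle_eq_top` reduces `M ≤ Soc` to abelian normal subgroups, which lie in the socle of
a Frattini-free group by Gaschütz.

For `F*(G)`, three facts suffice: it has the property (`tildeF_genFitting`), it contains every
normal subgroup equal to its own socle (`le_genFitting`), and its centralizer lies in `F(G)`. -/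

namespace GenFitting

open Subgroup
open scoped commutatorElement

/-! ### Groups equal to their own socle -/

section Socle

variable {G H : Type*} [Group G] [Group H]

lemma exists_isMinimalNormal_le [Finite G] {K : Subgroup G} (hK : K.Normal) (hb : K ≠ ⊥) :
    ∃ M, IsMinimalNormal M ∧ M ≤ K := by
  obtain ⟨M, hle, hM⟩ := exists_minimal_le_of_wellFoundedLT
    (fun K : Subgroup G => K.Normal ∧ K ≠ ⊥) K ⟨hK, hb⟩
  exact ⟨M, hM, hle⟩

lemma IsMinimalNormal.le_socle {M : Subgroup G} (hM : IsMinimalNormal M) : M ≤ socle G :=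
  le_sSup hM

lemma IsMinimalNormal.inf_eq_bot_or_le {M K : Subgroup G} (hM : IsMinimalNormal M)
    (hK : K.Normal) : M ⊓ K = ⊥ ∨ M ≤ K := by
  by_cases h : M ⊓ K = ⊥
  · exact Or.inl h
  · have := hM.prop.1
    exact Or.inr ((hM.le_of_le ⟨inferInstance, h⟩ inf_le_left).trans inf_le_right)

lemma IsMinimalNormal.map_eq_bot_or {f : G →* H} (hf : Function.Surjective f) {M : Subgroup G}
    (hM : IsMinimalNormal M) : M.map f = ⊥ ∨ IsMinimalNormal (M.map f) := by
  by_cases h : M.map f = ⊥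
  · exact Or.inl h
  refine Or.inr ⟨⟨hM.prop.1.map f hf, h⟩, ?_⟩
  rintro K ⟨hK, hKb⟩ hKM
  have hKM' : K ≤ M.map f := hKM
  rcases hM.inf_eq_bot_or_le (hK.comap f) with h0 | hle
  · refine absurd ((eq_bot_iff_forall _).2 fun k hk => ?_) hKb
    obtain ⟨m, hm, rfl⟩ := hKM' hk
    have : m ∈ M ⊓ K.comap f := ⟨hm, hk⟩
    rw [h0, mem_bot] at this
    rw [this, map_one]
  · exact map_le_iff_le_comap.2 hle

lemma map_socle_le {f : G →* H} (hf : Function.Surjective f) :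
    (socle G).map f ≤ socle H := by
  rw [map_le_iff_le_comap]
  refine sSup_le fun M hM => map_le_iff_le_comap.1 ?_
  rcases IsMinimalNormal.map_eq_bot_or hf hM with h | h
  · rw [h]; exact bot_le
  · exact h.le_socle

instance socle_characteristic : (socle G).Characteristic :=
  characteristic_iff_map_le.2 fun φ => map_socle_le φ.surjective

lemma socle_eq_top_of_surjective {f : G →* H} (hf : Function.Surjective f) (h : socle G = ⊤) :
    socle H = ⊤ := by
  rw [eq_top_iff, ← map_top_of_surjective f hf, ← h]
  exact map_socle_le hf

/-- The kernel condition makes `B` a quotient of `A`; this avoids iterated quotients. -/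
lemma socle_eq_top_of_ker_le {A B : Type*} [Group A] [Group B] {f : G →* A} {g : G →* B}
    (hf : Function.Surjective f) (hg : Function.Surjective g) (hle : f.ker ≤ g.ker)
    (h : socle A = ⊤) : socle B = ⊤ := by
  refine socle_eq_top_of_surjective (f := f.liftOfSurjective hf ⟨g, hle⟩) (fun b => ?_) h
  obtain ⟨x, rfl⟩ := hg b
  exact ⟨f x, MonoidHom.liftOfRightInverse_comp_apply f _ _ ⟨g, hle⟩ x⟩

/-- The inner socle is characteristic in `socle G`, hence normal in `G`, and it meets every minimal
normal subgroup of `G` nontrivially. -/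
lemma socle_socle [Finite G] : socle (socle G) = ⊤ := by
  have key : socle G ≤ (socle (socle G)).map (socle G).subtype := by
    refine sSup_le fun M hM => ?_
    have hM' : IsMinimalNormal M := hM
    rcases hM'.inf_eq_bot_or_le
      (inferInstance : ((socle (socle G)).map (socle G).subtype).Normal) with h0 | hle
    · have := hM'.prop.1
      have hb : M.subgroupOf (socle G) ≠ ⊥ := by
        rw [Ne, subgroupOf_eq_bot, disjoint_iff, inf_eq_left.2 hM'.le_socle]
        exact hM'.prop.2
      obtain ⟨L, hL, hLM⟩ := exists_isMinimalNormal_le inferInstance hb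
      refine absurd ((eq_bot_iff_forall _).2 fun x hx => ?_) hL.prop.2
      have : (x : G) ∈ M ⊓ (socle (socle G)).map (socle G).subtype :=
        ⟨hLM hx, mem_map_of_mem (socle G).subtype (hL.le_socle hx)⟩
      rw [h0, mem_bot] at this
      exact Subtype.ext this
    · exact hle
  rw [eq_top_iff]
  rintro ⟨x, hx⟩ -
  obtain ⟨y, hy, rfl⟩ := key hx
  exact hy

/-- If the socle is the whole group, then normal subgroups have normal complements. -/
lemma exists_normal_complement [Finite G] (hG : socle G = ⊤) (K : Subgroup G) [K.Normal] :
    ∃ C : Subgroup G, C.Normal ∧ K ⊔ C = ⊤ ∧ K ⊓ C = ⊥ := by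
  obtain ⟨C, -, hC⟩ := exists_maximal_ge_of_wellFoundedGT
    (fun C : Subgroup G => C.Normal ∧ K ⊓ C = ⊥) ⊥ ⟨inferInstance, inf_bot_eq K⟩
  have := hC.prop.1
  refine ⟨C, hC.prop.1, ?_, hC.prop.2⟩
  rw [eq_top_iff, ← hG]
  refine sSup_le fun M hM => ?_
  have hM' : IsMinimalNormal M := hM
  have := hM'.prop.1
  rcases hM'.inf_eq_bot_or_le (inferInstance : (K ⊔ C).Normal) with h0 | hle
  -- If `M` meets `KC` trivially, then `CM` still avoids `K`, so maximality of `C` forces `M ≤ C`.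
  · have hCM : K ⊓ (C ⊔ M) = ⊥ := by
      rw [eq_bot_iff_forall]
      rintro k ⟨hk, hk'⟩
      obtain ⟨c, hc, m, hm, rfl⟩ := mem_sup_of_normal_right.1 hk'
      have hmem : m ∈ M ⊓ (K ⊔ C) := by
        refine ⟨hm, ?_⟩
        have : c⁻¹ * (c * m) ∈ K ⊔ C :=
          mul_mem (inv_mem (mem_sup_right hc)) (mem_sup_left hk)
        simpa using this
      rw [h0, mem_bot] at hmem
      subst hmem
      have : c * 1 ∈ K ⊓ C := ⟨hk, by simpa using hc⟩
      rwa [hC.prop.2, mem_bot] at this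
    exact (le_sup_right.trans (hC.le_of_ge ⟨inferInstance, hCM⟩ le_sup_left)).trans le_sup_right
  · exact hle

lemma isQuasinilpotent_of_socle_eq_top [Finite G] (hG : socle G = ⊤) : IsQuasinilpotent G := by
  rintro H K ⟨hH, hK, -, -⟩ g
  obtain ⟨C, hC, hsup, hinf⟩ := exists_normal_complement hG H
  -- The component `c` centralizes `H`, so `g` acts on `H` as `h` does.
  obtain ⟨h, hh, c, hc, rfl⟩ := mem_sup_of_normal_right.1 (hsup ▸ mem_top g : g ∈ H ⊔ C)
  refine ⟨h, hh, fun x hx => ?_⟩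
  have hcx : c * x = x * c :=
    ((commute_of_normal_of_disjoint H C hH hC (disjoint_iff.2 hinf) x c hx hc).eq).symm
  have : (h * x * h⁻¹)⁻¹ * (h * c * x * (h * c)⁻¹) = 1 := by
    rw [mul_assoc h c x, hcx]; group
  rw [this]
  exact one_mem K

/-- Complements inside a subgroup that equals its own socle. -/
lemma exists_complement_of_socle_eq_top {E D : Subgroup G} [Finite E] (hE : socle E = ⊤)
    (hDE : D ≤ E) (hD : ∀ e ∈ E, ∀ d ∈ D, e * d * e⁻¹ ∈ D) :
    ∃ C ≤ E, (∀ e ∈ E, ∀ c ∈ C, e * c * e⁻¹ ∈ C) ∧ (∀ e ∈ E, ∃ d ∈ D, ∃ c ∈ C, d * c = e) ∧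
      D ⊓ C = ⊥ ∧ ∀ d ∈ D, ∀ c ∈ C, d * c = c * d := by
  have hn : (D.subgroupOf E).Normal := ⟨fun d hd e => hD e e.2 d hd⟩
  obtain ⟨C, hC, hsup, hinf⟩ := exists_normal_complement hE (D.subgroupOf E)
  refine ⟨C.map E.subtype, map_subtype_le C, ?_, ?_, ?_, ?_⟩
  · rintro e he _ ⟨c, hc, rfl⟩
    exact ⟨⟨e, he⟩ * c * ⟨e, he⟩⁻¹, hC.conj_mem c hc _, rfl⟩
  · intro e he
    obtain ⟨d, hd, c, hc, h⟩ := mem_sup_of_normal_right.1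
      (hsup ▸ mem_top (⟨e, he⟩ : E) : (⟨e, he⟩ : E) ∈ D.subgroupOf E ⊔ C)
    exact ⟨d, hd, c, mem_map_of_mem E.subtype hc, congrArg E.subtype h⟩
  · rw [eq_bot_iff_forall]
    rintro _ ⟨hd, c, hc, rfl⟩
    have : c ∈ D.subgroupOf E ⊓ C := ⟨hd, hc⟩
    rw [hinf, mem_bot] at this
    rw [this, map_one]
  · rintro d hd _ ⟨c, hc, rfl⟩
    exact congrArg E.subtype (commute_of_normal_of_disjoint _ C hn hC (disjoint_iff.2 hinf)
      ⟨d, hDE hd⟩ c hd hc).eq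

/-- Let `B` complement this intersection in `E`. Modifying elements of `D` by the intersection,
which is central in `D`, moves them into `B` without changing commutators, so `⁅D, D⁆ ≤ B`. -/
lemma commutator_inf_centralizer_eq_bot {E D : Subgroup G} [Finite E] (hE : socle E = ⊤)
    (hDE : D ≤ E) (hD : ∀ e ∈ E, ∀ d ∈ D, e * d * e⁻¹ ∈ D) :
    ⁅D, D⁆ ⊓ centralizer (D : Set G) = ⊥ := by
  have hZD : ⁅D, D⁆ ⊓ centralizer (D : Set G) ≤ D := inf_le_left.trans (commutator_le_self D)
  have hcomm : ∀ e ∈ E, ∀ d ∈ ⁅D, D⁆, e * d * e⁻¹ ∈ ⁅D, D⁆ := by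
    intro e he d hd
    have hmap : D.map (MulAut.conj e).toMonoidHom ≤ D := by
      rintro _ ⟨d, hd, rfl⟩
      exact hD e he d hd
    have := mem_map_of_mem (MulAut.conj e).toMonoidHom hd
    rw [map_commutator] at this
    exact commutator_mono hmap hmap this
  obtain ⟨B, -, -, hdec, hinf, -⟩ := exists_complement_of_socle_eq_top hE (hZD.trans hDE)
    (fun e he d hd => by
      refine ⟨hcomm e he d hd.1, fun x hx => ?_⟩
      have h1 := hd.2 (e⁻¹ * x * e⁻¹⁻¹) (hD _ (inv_mem he) x hx)
      have h2 : x * (e * d * e⁻¹) = e * ((e⁻¹ * x * e⁻¹⁻¹) * d) * e⁻¹ := by group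
      have h3 : (e * d * e⁻¹) * x = e * (d * (e⁻¹ * x * e⁻¹⁻¹)) * e⁻¹ := by group
      rw [h2, h3, h1])
  have hDB : ⁅D, D⁆ ≤ B := by
    rw [commutator_le]
    intro x hx y hy
    obtain ⟨z, hz, b, hb, rfl⟩ := hdec x (hDE hx)
    obtain ⟨w, hw, c, hc, rfl⟩ := hdec y (hDE hy)
    have hbD : b ∈ D := by simpa using mul_mem (inv_mem (hZD hz)) hx
    have hcD : c ∈ D := by simpa using mul_mem (inv_mem (hZD hw)) hy
    have e1 : ⁅z * b, w * c⁆ = ⁅b, c⁆ := by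
      have z1 : ∀ u ∈ D, u * z = z * u := fun u hu => hz.2 u hu
      have w1 : ∀ u ∈ D, u * w = w * u := fun u hu => hw.2 u hu
      have a1 := w1 b hbD
      have a2 : (z * b) * (w * c) = z * w * (b * c) := by
        rw [mul_assoc z b, ← mul_assoc b w, a1]; group
      have a3 : (w * c) * (z * b) = z * w * (c * b) := by
        rw [mul_assoc w c, ← mul_assoc c z, z1 c hcD, w1 z (hZD hz)]; group
      rw [commutatorElement_def, commutatorElement_def]
      have : z * b * (w * c) * (z * b)⁻¹ * (w * c)⁻¹ = (z * b * (w * c)) * (w * c * (z * b))⁻¹ := by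
        group
      rw [this, a2, a3]
      have b1 : z * w * (b * c) * (z * w * (c * b))⁻¹
          = (z * w) * (b * c * b⁻¹ * c⁻¹) * (z * w)⁻¹ := by group
      rw [b1]
      have hm : b * c * b⁻¹ * c⁻¹ ∈ D :=
        mul_mem (mul_mem (mul_mem hbD hcD) (inv_mem hbD)) (inv_mem hcD)
      have : (z * w) * (b * c * b⁻¹ * c⁻¹) = (b * c * b⁻¹ * c⁻¹) * (z * w) := by
        rw [mul_assoc, ← w1 _ hm, ← mul_assoc, ← z1 _ hm, mul_assoc]
      rw [this]; group
    rw [e1]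
    rw [commutatorElement_def]
    exact mul_mem (mul_mem (mul_mem hb hc) (inv_mem hb)) (inv_mem hc)
  rw [eq_bot_iff, ← hinf]
  exact le_inf le_rfl (inf_le_left.trans hDB)

lemma le_centralizer_of_commutator_eq_bot {E D : Subgroup G} [Finite E] (hE : socle E = ⊤)
    (hDE : D ≤ E) (hD : ∀ e ∈ E, ∀ d ∈ D, e * d * e⁻¹ ∈ D) (h : ⁅D, D⁆ = ⊥) :
    D ≤ centralizer (E : Set G) := by
  obtain ⟨C, -, -, hdec, -, hcom⟩ := exists_complement_of_socle_eq_top hE hDE hD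
  intro d hd e he
  obtain ⟨x, hx, c, hc, rfl⟩ := hdec e he
  have h1 : x * d = d * x := commutator_eq_bot_iff_le_centralizer.1 h hd x hx
  rw [mul_assoc, ← hcom d hd c hc, ← mul_assoc, h1, mul_assoc]

/-- A last nontrivial lower central term inside `⁅D, D⁆` would centralize `D`, so `D` is abelian. -/
lemma le_centralizer_of_isNilpotent {E D : Subgroup G} [Finite E] (hE : socle E = ⊤)
    (hDE : D ≤ E) (hD : ∀ e ∈ E, ∀ d ∈ D, e * d * e⁻¹ ∈ D) (h : Group.IsNilpotent D) :
    D ≤ centralizer (E : Set G) := by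
  obtain ⟨n, hn⟩ := (isNilpotent_iff_lowerCentralSeries D).1 h
  have key : ∀ n, D.lowerCentralSeries (n + 1) = ⊥ → ⁅D, D⁆ = ⊥ := by
    intro n
    induction n with
    | zero => exact id
    | succ n ih =>
      intro h
      apply ih
      rw [eq_bot_iff, ← commutator_inf_centralizer_eq_bot hE hDE hD]
      refine le_inf (D.lowerCentralSeries_antitone (Nat.le_add_left 1 n)) ?_
      exact commutator_eq_bot_iff_le_centralizer.1 h
  refine le_centralizer_of_commutator_eq_bot hE hDE hD (key n ?_)
  rw [eq_bot_iff, ← hn]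
  exact D.lowerCentralSeries_antitone (Nat.le_succ n)

/-- A normal subgroup equal to its own socle lies in the socle as soon as the abelian normal
subgroups below it do. -/
lemma le_socle_of_socle_eq_top [Finite G] {E : Subgroup G} [E.Normal] (hE : socle E = ⊤)
    (h : ∀ K : Subgroup G, K.Normal → K ≤ E → ⁅K, K⁆ = ⊥ → K ≤ socle G) : E ≤ socle G := by
  have hSn : ∀ e ∈ E, ∀ d ∈ E ⊓ socle G, e * d * e⁻¹ ∈ E ⊓ socle G := fun e _ d hd =>
    (inferInstance : (E ⊓ socle G).Normal).conj_mem d hd e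
  obtain ⟨C, hCE, -, hdec, -, hcom⟩ := exists_complement_of_socle_eq_top hE inf_le_left hSn
  -- `D` contains the complement `C`. A minimal normal subgroup inside `⁅D, D⁆` would lie in `E ⊓
  -- socle G` and so centralize `D`; hence `D` is abelian.
  set D : Subgroup G := E ⊓ centralizer ((E ⊓ socle G : Subgroup G) : Set G) with hDdef
  have hDb : ⁅D, D⁆ = ⊥ := by
    by_contra hne
    obtain ⟨K, hK, hKD⟩ := exists_isMinimalNormal_le (inferInstance : ⁅D, D⁆.Normal) hne
    have hKS : K ≤ E ⊓ socle G :=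
      le_inf (hKD.trans ((commutator_le_self D).trans inf_le_left)) hK.le_socle
    refine hK.prop.2 (eq_bot_iff.2 ?_)
    rw [← commutator_inf_centralizer_eq_bot hE (inf_le_left : D ≤ E)
      fun e _ d hd => (inferInstance : D.Normal).conj_mem d hd e]
    refine le_inf hKD fun k hk d hd => ?_
    exact (hd.2 k (hKS hk)).symm
  have hDS : D ≤ socle G := h D inferInstance inf_le_left hDb
  intro e he
  obtain ⟨d, hd, c, hc, rfl⟩ := hdec e he
  exact mul_mem hd.2 (hDS ⟨hCE hc, fun x hx => hcom x hx c hc⟩)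

/-- Minimal normal subgroups of a factor in a central product are minimal normal. -/
lemma map_socle_le_of_centralizer {M : Subgroup G}
    (hM : ∀ g : G, ∃ z ∈ centralizer (M : Set G), ∃ m ∈ M, z * m = g) :
    (socle M).map M.subtype ≤ socle G := by
  rw [map_le_iff_le_comap]
  refine sSup_le fun K hK => map_le_iff_le_comap.1 (IsMinimalNormal.le_socle ?_)
  have hK' : IsMinimalNormal K := hK
  refine ⟨⟨⟨?_⟩, fun h => hK'.prop.2 ((map_eq_bot_iff_of_injective K M.subtype_injective).1 h)⟩, ?_⟩
  · rintro _ ⟨k, hk, rfl⟩ g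
    obtain ⟨z, hz, m, hm, rfl⟩ := hM g
    refine ⟨⟨m, hm⟩ * k * ⟨m, hm⟩⁻¹, hK'.prop.1.conj_mem k hk _, ?_⟩
    have h1 : m * k * m⁻¹ * z = z * (m * k * m⁻¹) :=
      hz _ (mul_mem (mul_mem hm k.2) (inv_mem hm))
    have h2 : z * m * k * (z * m)⁻¹ = z * (m * k * m⁻¹) * z⁻¹ := by group
    change m * k * m⁻¹ = z * m * k * (z * m)⁻¹
    rw [h2, ← h1]; group
  · rintro L ⟨hL, hLb⟩ hLK
    have hLK' : L ≤ K.map M.subtype := hLK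
    have hLM : L ≤ M := hLK'.trans (map_subtype_le K)
    refine map_le_iff_le_comap.2 (hK'.le_of_le ⟨hL.comap M.subtype, ?_⟩ ?_)
    · intro hb
      rw [show L.comap M.subtype = L.subgroupOf M from rfl, subgroupOf_eq_bot, disjoint_iff,
        inf_eq_left.2 hLM] at hb
      exact hLb hb
    · intro x hx
      obtain ⟨k, hk, hkx⟩ := hLK' hx
      rwa [← M.subtype_injective hkx]

end Socle

/-! ### Frattini subgroups and Gaschütz's complements -/

section Frattini

variable {G : Type*} [Group G]

lemma frattini_quotient_frattini : frattini (G ⧸ frattini G) = ⊥ := by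
  rw [eq_bot_iff_forall]
  intro x hx
  obtain ⟨g, rfl⟩ := QuotientGroup.mk'_surjective (frattini G) x
  rw [← MonoidHom.mem_ker, QuotientGroup.ker_mk']
  refine (mem_iInf.2 fun M => mem_iInf.2 fun hM => ?_ : g ∈ frattini G)
  have hker : (QuotientGroup.mk' (frattini G)).ker ≤ M := by
    rw [QuotientGroup.ker_mk']
    exact frattini_le_coatom hM
  have hcm := comap_map_eq_self hker
  have hco : IsCoatom (M.map (QuotientGroup.mk' (frattini G))) := by
    refine ⟨fun h => hM.1 ?_, fun N hN => ?_⟩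
    · rw [← hcm, h, comap_top]
    · have hlt : M < N.comap (QuotientGroup.mk' (frattini G)) := by
        rw [← hcm]
        exact (comap_lt_comap_of_surjective (QuotientGroup.mk'_surjective _)).2 hN
      rw [← map_comap_eq_self_of_surjective (QuotientGroup.mk'_surjective (frattini G)) N,
        hM.2 _ hlt, map_top_of_surjective _ (QuotientGroup.mk'_surjective _)]
  have : g ∈ (M.map (QuotientGroup.mk' (frattini G))).comap (QuotientGroup.mk' (frattini G)) :=
    frattini_le_coatom hco hx
  rwa [hcm] at this

/-- If a maximal `M` missed `K`, then `L = K(M ∩ L)` by Dedekind; as `K ≤ Φ(L)` is superfluous, `K ≤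
L ≤ M`. -/
lemma le_frattini_of_le_map_frattini [Finite G] {K L : Subgroup G} [K.Normal]
    (h : K ≤ (frattini L).map L.subtype) : K ≤ frattini G := by
  refine le_iInf fun M => le_iInf fun hM => ?_
  by_contra hKM
  have hsup : K ⊔ M = ⊤ := hM.2 _ (right_lt_sup.2 hKM)
  have hL : M.subgroupOf L = ⊤ := by
    refine frattini_nongenerating (eq_top_iff.2 ?_)
    rintro ⟨l, hl⟩ -
    obtain ⟨k, hk, m, hm, hkm⟩ := mem_sup_of_normal_left.1 (hsup ▸ mem_top l : l ∈ K ⊔ M)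
    obtain ⟨k', hk', rfl⟩ := h hk
    have hmL : m ∈ L := by
      rw [show m = ((k' : G))⁻¹ * l from by rw [← hkm]; simp]
      exact mul_mem (inv_mem k'.2) hl
    have : (⟨l, hl⟩ : L) = k' * ⟨m, hmL⟩ := Subtype.ext hkm.symm
    rw [this]
    exact mul_mem (mem_sup_right hk') (mem_sup_left hm)
  rw [subgroupOf_eq_top] at hL
  exact hKM (h.trans ((map_subtype_le _).trans hL))

lemma map_frattini_le_of_normal [Finite G] (M : Subgroup G) [M.Normal] :
    (frattini M).map M.subtype ≤ frattini G :=
  le_frattini_of_le_map_frattini (L := M) le_rfl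

/-- Fix a maximal `M` and go up the lower central series from the trivial term. If a term escapes
`M` while the next one lies in `M`, the former supplements `M` and is central in `N` modulo the
latter, so commutators of `N` agree with those of `N ∩ M` modulo a subgroup of `M`. -/
lemma commutator_le_frattini_of_isNilpotent (N : Subgroup G) [N.Normal]
    (hN : Group.IsNilpotent N) : ⁅N, N⁆ ≤ frattini G := by
  refine le_iInf fun M => le_iInf fun hM => ?_
  obtain ⟨n, hn⟩ := (isNilpotent_iff_lowerCentralSeries N).1 hN
  have key : ∀ n, N.lowerCentralSeries n ≤ M → ⁅N, N⁆ ≤ M := by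
    intro n
    induction n with
    | zero => exact (commutator_le_self N).trans
    | succ n ih =>
      intro h
      by_cases hle : N.lowerCentralSeries n ≤ M
      · exact ih hle
      have hsup : N.lowerCentralSeries n ⊔ M = ⊤ := hM.2 _ (right_lt_sup.2 hle)
      set R := N.lowerCentralSeries (n + 1) with hR
      let π := QuotientGroup.mk' R
      have hdec : ∀ x ∈ N, ∃ m ∈ M, ∃ a ∈ N.lowerCentralSeries n, m ∈ N ∧ a * m = x := by
        intro x hx
        obtain ⟨a, ha, m, hm, rfl⟩ := mem_sup_of_normal_left.1
          (hsup ▸ mem_top x : x ∈ N.lowerCentralSeries n ⊔ M)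
        refine ⟨m, hm, a, ha, ?_, rfl⟩
        simpa using mul_mem (inv_mem (N.lowerCentralSeries_le_self n ha)) hx
      have hcen : ∀ a ∈ N.lowerCentralSeries n, ∀ x ∈ N, Commute (π a) (π x) := by
        intro a ha x hx
        rw [← commutatorElement_eq_one_iff_commute, ← map_commutatorElement, ← MonoidHom.mem_ker,
          QuotientGroup.ker_mk']
        exact commutator_mem_commutator ha hx
      rw [commutator_le]
      intro x hx y hy
      obtain ⟨m, hm, a, ha, hmN, rfl⟩ := hdec x hx
      obtain ⟨m', hm', b, hb, hmN', rfl⟩ := hdec y hy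
      have e : π ⁅a * m, b * m'⁆ = π ⁅m, m'⁆ := by
        have e1 : π (a * m * (b * m')) = π (a * b) * π (m * m') := by
          simp only [map_mul]
          rw [mul_assoc, ← mul_assoc (π m), ← (hcen b hb m hmN).eq]
          simp only [mul_assoc]
        have e2 : π (b * m' * (a * m)) = π (a * b) * π (m' * m) := by
          simp only [map_mul]
          rw [(hcen a ha b (N.lowerCentralSeries_le_self n hb)).eq, mul_assoc,
            ← mul_assoc (π m'), ← (hcen a ha m' hmN').eq]
          simp only [mul_assoc]
        have e3 : Commute (π (a * b)) (π (m * m' * (m' * m)⁻¹)) := by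
          refine hcen _ (mul_mem ha hb) _ ?_
          exact mul_mem (mul_mem hmN hmN') (inv_mem (mul_mem hmN' hmN))
        have f1 : ⁅a * m, b * m'⁆ = a * m * (b * m') * (b * m' * (a * m))⁻¹ := by
          rw [commutatorElement_def]; group
        have f2 : ⁅m, m'⁆ = m * m' * (m' * m)⁻¹ := by
          rw [commutatorElement_def]; group
        rw [f1, f2, map_mul, map_inv, e1, e2, mul_inv_rev, mul_assoc, ← mul_assoc (π (m * m')),
          ← map_inv, ← map_mul π (m * m'), ← mul_assoc, e3.eq, mul_assoc, mul_inv_cancel, mul_one]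
      have hker : ⁅m, m'⁆⁻¹ * ⁅a * m, b * m'⁆ ∈ R := by
        rw [← QuotientGroup.ker_mk' R, MonoidHom.mem_ker, map_mul, map_inv]
        exact inv_mul_eq_one.2 e.symm
      have hmm : ⁅m, m'⁆ ∈ M := by
        rw [commutatorElement_def]
        exact mul_mem (mul_mem (mul_mem hm hm') (inv_mem hm)) (inv_mem hm')
      rw [← mul_inv_cancel_left ⁅m, m'⁆ ⁅a * m, b * m'⁆]
      exact mul_mem hmm (h hker)
  exact key n (hn ▸ bot_le)

lemma normal_inf_of_mul_centralizer {A L : Subgroup G} [A.Normal]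
    (h : ∀ g : G, ∃ a ∈ centralizer (A : Set G), ∃ l ∈ L, a * l = g) : (A ⊓ L).Normal := by
  refine ⟨fun x hx g => ?_⟩
  obtain ⟨hxA, hxL⟩ := mem_inf.1 hx
  obtain ⟨a, ha, l, hl, rfl⟩ := h g
  have h1 : l * x * l⁻¹ ∈ A ⊓ L :=
    mem_inf.2 ⟨(inferInstance : A.Normal).conj_mem x hxA l, mul_mem (mul_mem hl hxL) (inv_mem hl)⟩
  have h2 : a * (l * x * l⁻¹) = l * x * l⁻¹ * a := (ha _ h1.1).symm
  have h3 : a * l * x * (a * l)⁻¹ = a * (l * x * l⁻¹) * a⁻¹ := by group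
  rwa [h3, h2, mul_inv_cancel_right]

/-- Gaschütz: if the Frattini subgroup is trivial, abelian normal subgroups are complemented. -/
lemma exists_complement_of_frattini_eq_bot [Finite G] (hG : frattini G = ⊥) {A : Subgroup G}
    [A.Normal] (hA : ⁅A, A⁆ = ⊥) : ∃ L : Subgroup G, A ⊔ L = ⊤ ∧ A ⊓ L = ⊥ := by
  obtain ⟨L, -, hL⟩ := exists_minimal_le_of_wellFoundedLT
    (fun L : Subgroup G => A ⊔ L = ⊤) ⊤ (by simp)
  refine ⟨L, hL.prop, ?_⟩
  have hdec : ∀ g : G, ∃ a ∈ A, ∃ l ∈ L, a * l = g := fun g =>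
    mem_sup_of_normal_left.1 (hL.prop ▸ mem_top g : g ∈ A ⊔ L)
  have hA' := commutator_eq_bot_iff_le_centralizer.1 hA
  have hn : (A ⊓ L).Normal := normal_inf_of_mul_centralizer fun g =>
    let ⟨a, ha, l, hl, h⟩ := hdec g
    ⟨a, hA' ha, l, hl, h⟩
  rw [eq_bot_iff, ← hG]
  -- If a maximal `M` missed `A ⊓ L`, then `L ⊓ M` would also supplement `A`, against minimality of
  -- `L`.
  refine le_iInf fun M => le_iInf fun hM => ?_
  by_contra hle
  have hsup : A ⊓ L ⊔ M = ⊤ := hM.2 _ (right_lt_sup.2 hle)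
  have hLM : A ⊔ L ⊓ M = ⊤ := by
    rw [eq_top_iff, ← hL.prop]
    refine sup_le le_sup_left fun l hl => ?_
    obtain ⟨a, ha, m, hm, rfl⟩ := mem_sup_of_normal_left.1 (hsup ▸ mem_top l : l ∈ A ⊓ L ⊔ M)
    exact mul_mem (mem_sup_left ha.1)
      (mem_sup_right ⟨by simpa using mul_mem (inv_mem (mem_inf.1 ha).2) hl, hm⟩)
  exact hle (inf_le_right.trans ((hL.le_of_le hLM inf_le_left).trans inf_le_right))

/-- Let `L` complement `A ⊓ socle G`. Then `A ⊓ L` is normal and contains no minimal normal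
subgroup, so it is trivial. -/
lemma le_socle_of_frattini_eq_bot [Finite G] (hG : frattini G = ⊥) {A : Subgroup G}
    [A.Normal] (hA : ⁅A, A⁆ = ⊥) : A ≤ socle G := by
  have hK : ⁅A ⊓ socle G, A ⊓ socle G⁆ = ⊥ :=
    eq_bot_iff.2 (hA ▸ commutator_mono inf_le_left inf_le_left)
  obtain ⟨L, hsup, hinf⟩ := exists_complement_of_frattini_eq_bot hG hK
  have hdec : ∀ g : G, ∃ a ∈ A ⊓ socle G, ∃ l ∈ L, a * l = g := fun g =>
    mem_sup_of_normal_left.1 (hsup ▸ mem_top g : g ∈ A ⊓ socle G ⊔ L)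
  have hA' := commutator_eq_bot_iff_le_centralizer.1 hA
  have hn : (A ⊓ L).Normal := normal_inf_of_mul_centralizer fun g =>
    let ⟨a, ha, l, hl, h⟩ := hdec g
    ⟨a, hA' ha.1, l, hl, h⟩
  have hb : A ⊓ L = ⊥ := by
    by_contra hne
    obtain ⟨M, hM, hMA⟩ := exists_isMinimalNormal_le hn hne
    refine hM.prop.2 (eq_bot_iff.2 (hinf ▸ ?_))
    exact le_inf (le_inf (hMA.trans inf_le_left) hM.le_socle) (hMA.trans inf_le_right)
  intro a ha
  obtain ⟨s, hs, l, hl, rfl⟩ := hdec a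
  have : l ∈ A ⊓ L := ⟨by simpa using mul_mem (inv_mem (mem_inf.1 hs).1) ha, hl⟩
  rw [hb, mem_bot] at this
  rw [this, mul_one]
  exact hs.2

/-- With `L` complementing `⁅A, B⁆`, which centralizes both `A` and `B`, every generating commutator
can be computed in `L`. -/
lemma commutator_eq_bot_of_frattini_eq_bot [Finite G] (hG : frattini G = ⊥) {A B : Subgroup G}
    [A.Normal] [B.Normal] (hA : ⁅A, A⁆ = ⊥) (hB : ⁅B, B⁆ = ⊥) : ⁅A, B⁆ = ⊥ := by
  have hKA : ⁅A, B⁆ ≤ A := commutator_le_left A B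
  have hKB : ⁅A, B⁆ ≤ B := commutator_le_right A B
  obtain ⟨L, hsup, hinf⟩ := exists_complement_of_frattini_eq_bot hG
    (eq_bot_iff.2 (hA ▸ commutator_mono hKA hKA) : ⁅⁅A, B⁆, ⁅A, B⁆⁆ = ⊥)
  have hA' := commutator_eq_bot_iff_le_centralizer.1 hA
  have hB' := commutator_eq_bot_iff_le_centralizer.1 hB
  have hdec : ∀ g : G, ∃ a ∈ ⁅A, B⁆, ∃ l ∈ L, a * l = g := fun g =>
    mem_sup_of_normal_left.1 (hsup ▸ mem_top g : g ∈ ⁅A, B⁆ ⊔ L)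
  rw [eq_bot_iff, ← hinf]
  refine le_inf le_rfl (commutator_le.2 fun x hx y hy => ?_)
  obtain ⟨k, hk, l, hl, rfl⟩ := hdec x
  obtain ⟨k', hk', l', hl', rfl⟩ := hdec y
  have hlA : l ∈ A := by simpa using mul_mem (inv_mem (hKA hk)) hx
  have hlB : l' ∈ B := by simpa using mul_mem (inv_mem (hKB hk')) hy
  have cA : ∀ k ∈ ⁅A, B⁆, Commute k l := fun k hk => hA' hlA k (hKA hk)
  have cB : ∀ k ∈ ⁅A, B⁆, Commute k l' := fun k hk => hB' hlB k (hKB hk)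
  have ck : Commute k k' := hA' (hKA hk') k (hKA hk)
  have h1 : Commute k ⁅l, k' * l'⁆ := by
    have : Commute k (k' * l') := ck.mul_right (cB k hk)
    rw [commutatorElement_def]
    exact (((cA k hk).mul_right this).mul_right (cA k hk).inv_right).mul_right this.inv_right
  have e : ⁅k * l, k' * l'⁆ = ⁅l, l'⁆ := by
    have e1 : k * l * (k' * l') = k * k' * (l * l') := by
      rw [mul_assoc, ← mul_assoc l, ← (cA k' hk').eq]; group
    have e2 : k' * l' * (k * l) = k * k' * (l' * l) := by
      rw [mul_assoc, ← mul_assoc l', ← (cB k hk).eq, ck.eq]; group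
    have e3 : Commute (k * k') (l * l' * (l' * l)⁻¹) := by
      have c1 : Commute (k * k') l := (cA k hk).mul_left (cA k' hk')
      have c2 : Commute (k * k') l' := (cB k hk).mul_left (cB k' hk')
      exact (c1.mul_right c2).mul_right (c2.mul_right c1).inv_right
    have f : ∀ x y : G, ⁅x, y⁆ = x * y * (y * x)⁻¹ := fun x y => by
      rw [commutatorElement_def]; group
    rw [f, f, e1, e2, mul_inv_rev, mul_assoc, ← mul_assoc (l * l'), ← mul_assoc, e3.eq,
      mul_assoc, mul_inv_cancel, mul_one]
  rw [e, commutatorElement_def]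
  exact mul_mem (mul_mem (mul_mem hl hl') (inv_mem hl)) (inv_mem hl')

end Frattini

/-! ### The limit as the largest normal subgroup with `tildeF M = ⊤` -/

section TildeF

variable {G H : Type*} [Group G] [Group H]

lemma tildeF_eq_top_iff : tildeF G = ⊤ ↔ socle (G ⧸ frattini G) = ⊤ := by
  rw [tildeF, ← comap_top (QuotientGroup.mk' (frattini G)),
    (comap_injective (QuotientGroup.mk'_surjective (frattini G))).eq_iff]

lemma map_tildeF_le {f : G →* H} (hf : Function.Surjective f) :
    (tildeF G).map f ≤ tildeF H := by
  rintro _ ⟨x, hx, rfl⟩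
  have hmap : Function.Surjective (QuotientGroup.map (frattini G) (frattini H) f
      (frattini_le_comap_frattini_of_surjective hf)) := by
    intro y
    obtain ⟨y, rfl⟩ := QuotientGroup.mk'_surjective _ y
    obtain ⟨x, rfl⟩ := hf y
    exact ⟨QuotientGroup.mk' _ x, rfl⟩
  exact map_socle_le hmap ⟨_, hx, rfl⟩

instance tildeF_characteristic : (tildeF G).Characteristic :=
  characteristic_iff_map_le.2 fun φ => map_tildeF_le φ.surjective

lemma tildeF_eq_top_of_surjective {f : G →* H} (hf : Function.Surjective f) (h : tildeF G = ⊤) :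
    tildeF H = ⊤ := by
  rw [eq_top_iff, ← map_top_of_surjective f hf, ← h]
  exact map_tildeF_le hf

/-- Since `Φ(M) ≤ Φ(G)`, the image of `M` in `G/Φ(G)` is a quotient of `M/Φ(M)`, hence its own
socle. -/
lemma le_tildeF [Finite G] {M : Subgroup G} [M.Normal] (hM : tildeF M = ⊤) : M ≤ tildeF G := by
  let π := QuotientGroup.mk' (frattini G)
  have hπ : Function.Surjective π := QuotientGroup.mk'_surjective _
  have : (M.map π).Normal := Normal.map inferInstance π hπ
  have hsoc : socle (M.map π) = ⊤ := by
    refine socle_eq_top_of_ker_le (f := QuotientGroup.mk' (frattini M)) (g := π.subgroupMap M)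
      (QuotientGroup.mk'_surjective _) (π.subgroupMap_surjective M) ?_ (tildeF_eq_top_iff.1 hM)
    rw [QuotientGroup.ker_mk']
    intro x hx
    have hx' : (x : G) ∈ frattini G := map_frattini_le_of_normal M (mem_map_of_mem M.subtype hx)
    rw [← QuotientGroup.ker_mk' (frattini G), MonoidHom.mem_ker] at hx'
    exact Subtype.ext hx'
  rw [tildeF, ← map_le_iff_le_comap]
  refine le_socle_of_socle_eq_top hsoc fun K hK _ hab => ?_
  exact le_socle_of_frattini_eq_bot frattini_quotient_frattini hab

instance tildeFSeries_characteristic (n : ℕ) : (tildeFSeries G n).Characteristic := by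
  induction n with
  | zero => exact topCharacteristic
  | succ n ih => exact characteristic_of_characteristic_of_characteristic

instance tildeFLim_characteristic : (tildeFLim G).Characteristic := by
  unfold tildeFLim; infer_instance

lemma tildeFSeries_antitone : Antitone (tildeFSeries G) :=
  antitone_nat_of_succ_le fun _ => map_subtype_le _

lemma tildeFLim_le_tildeF : tildeFLim G ≤ tildeF G := by
  refine (iInf_le _ 1).trans ?_
  exact map_tildeF_le (f := (⊤ : Subgroup G).subtype) fun x => ⟨⟨x, mem_top x⟩, rfl⟩

/-- The descending series stabilizes, and its stable term is fixed by `tildeF`. -/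
lemma tildeF_tildeFLim [Finite G] : tildeF (tildeFLim G) = ⊤ := by
  obtain ⟨n, hn⟩ := WellFoundedGT.monotone_chain_condition
    (⟨fun n => OrderDual.toDual (tildeFSeries G n), fun _ _ h => tildeFSeries_antitone h⟩ :
      ℕ →o (Subgroup G)ᵒᵈ)
  have hn' : ∀ m, n ≤ m → tildeFSeries G n = tildeFSeries G m := hn
  have hlim : tildeFLim G = tildeFSeries G n := by
    refine le_antisymm (iInf_le _ n) (le_iInf fun m => ?_)
    rcases le_total n m with h | h
    · exact (hn' m h).le
    · exact tildeFSeries_antitone h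
  have htop : tildeF (tildeFSeries G n) = ⊤ := by
    rw [← (map_injective (tildeFSeries G n).subtype_injective).eq_iff, ← MonoidHom.range_eq_map,
      range_subtype]
    exact (hn' (n + 1) n.le_succ).symm
  rw [hlim]
  exact htop

lemma le_tildeFLim [Finite G] {M : Subgroup G} [M.Normal] (hM : tildeF M = ⊤) :
    M ≤ tildeFLim G := by
  refine le_iInf fun n => ?_
  induction n with
  | zero => exact le_top
  | succ n ih =>
    have h : tildeF (M.subgroupOf (tildeFSeries G n)) = ⊤ :=
      tildeF_eq_top_of_surjective (f := (subgroupOfEquivOfLe ih).symm.toMonoidHom)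
        (subgroupOfEquivOfLe ih).symm.surjective hM
    intro x hx
    exact ⟨⟨x, ih hx⟩, le_tildeF h hx, rfl⟩

lemma map_tildeFLim_le [Finite G] [Finite H] {f : G →* H} (hf : Function.Surjective f) :
    (tildeFLim G).map f ≤ tildeFLim H := by
  have : ((tildeFLim G).map f).Normal := Normal.map inferInstance f hf
  exact le_tildeFLim (tildeF_eq_top_of_surjective (f.subgroupMap_surjective _) tildeF_tildeFLim)

lemma map_subtype_tildeFLim_le [Finite G] (N : Subgroup G) [N.Normal] :
    (tildeFLim N).map N.subtype ≤ tildeFLim G :=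
  le_tildeFLim
    (tildeF_eq_top_of_surjective (N.subtype.subgroupMap_surjective _) tildeF_tildeFLim)

/-- The projection onto a complement of a normal subgroup. -/
lemma exists_projection (N H : Subgroup G) [N.Normal] (hsup : N ⊔ H = ⊤) (hinf : N ⊓ H = ⊥) :
    ∃ p : G →* H, Function.Surjective p ∧ p.ker = N ∧ ∀ g, ((p g : G))⁻¹ * g ∈ N := by
  have hker : ∀ g, QuotientGroup.mk' N g = 1 ↔ g ∈ N := fun g => by
    rw [← MonoidHom.mem_ker, QuotientGroup.ker_mk']
  let e : H ≃* G ⧸ N := MulEquiv.ofBijective ((QuotientGroup.mk' N).comp H.subtype) <| by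
    constructor
    · refine (injective_iff_map_eq_one _).2 fun x hx => ?_
      have : (x : G) ∈ N ⊓ H := ⟨(hker x).1 hx, x.2⟩
      rw [hinf, mem_bot] at this
      exact Subtype.ext this
    · intro y
      obtain ⟨g, rfl⟩ := QuotientGroup.mk'_surjective N y
      obtain ⟨n, hn, h, hh, rfl⟩ := mem_sup_of_normal_left.1 (hsup ▸ mem_top g : g ∈ N ⊔ H)
      refine ⟨⟨h, hh⟩, ?_⟩
      rw [map_mul, (hker n).2 hn, one_mul]
      rfl
  refine ⟨e.symm.toMonoidHom.comp (QuotientGroup.mk' N),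
    e.symm.surjective.comp (QuotientGroup.mk'_surjective N), ?_, fun g => ?_⟩
  · ext g
    rw [MonoidHom.mem_ker, ← hker]
    exact e.symm.map_eq_one_iff
  · rw [← hker, map_mul, map_inv, inv_mul_eq_one]
    exact e.apply_symm_apply (QuotientGroup.mk' N g)

lemma exists_tildeFLim_factor [Finite G] (N H : Subgroup G) [N.Normal] (hsup : N ⊔ H = ⊤)
    (hinf : N ⊓ H = ⊥) {t : G} (ht : t ∈ tildeFLim G) :
    ∃ h ∈ (tildeFLim H).map H.subtype, h⁻¹ * t ∈ N := by
  obtain ⟨p, hp, -, hpN⟩ := exists_projection N H hsup hinf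
  exact ⟨p t, mem_map_of_mem _ (map_tildeFLim_le hp (mem_map_of_mem p ht)), hpN t⟩

lemma tildeFLim_internalDirectProduct [Finite G] (N H : Subgroup G) [N.Normal] [H.Normal]
    (h : IsInternalDirectProduct ⊤ N H) :
    IsInternalDirectProduct (tildeFLim G)
      ((tildeFLim H).map H.subtype) ((tildeFLim N).map N.subtype) := by
  obtain ⟨hsup, hinf, hcom⟩ := h
  refine ⟨le_antisymm (sup_le (map_subtype_tildeFLim_le H) (map_subtype_tildeFLim_le N)) ?_, ?_, ?_⟩
  · intro t ht
    obtain ⟨a, ha, haN⟩ := exists_tildeFLim_factor N H hsup hinf ht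
    obtain ⟨b, hb, hbH⟩ := exists_tildeFLim_factor H N (sup_comm N H ▸ hsup)
      (inf_comm N H ▸ hinf) ht
    have haH : a ∈ H := map_subtype_le _ ha
    have hbN : b ∈ N := map_subtype_le _ hb
    have hc := hcom _ haN a haH
    -- `a` and `b` are the projections of `t`; the discrepancy between `t` and `a * b` lies in both
    -- factors.
    have hmem : b⁻¹ * (a⁻¹ * t) ∈ N ⊓ H := by
      refine mem_inf.2 ⟨mul_mem (inv_mem hbN) haN, ?_⟩
      have h1 : a⁻¹ * t = t * a⁻¹ := by
        rw [eq_mul_inv_iff_mul_eq, hc, mul_inv_cancel_left]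
      rw [h1, ← mul_assoc]
      exact mul_mem hbH (inv_mem haH)
    rw [hinf, mem_bot, inv_mul_eq_one, eq_inv_mul_iff_mul_eq] at hmem
    rw [← hmem]
    exact mul_mem (mem_sup_left ha) (mem_sup_right hb)
  · rw [eq_bot_iff, ← hinf]
    exact le_inf (inf_le_right.trans (map_subtype_le _)) (inf_le_left.trans (map_subtype_le _))
  · exact fun a ha b hb => (hcom b (map_subtype_le _ hb) a (map_subtype_le _ ha)).symm

end TildeF

/-! ### The quasinilpotent radical -/

section QuasinilpotentRadical

variable {G : Type*} [Group G]

lemma le_fitting {N : Subgroup G} (hN : N.Normal) (h : Group.IsNilpotent N) : N ≤ fitting G :=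
  le_sSup ⟨hN, h⟩

lemma le_fitting_of_commutator_eq_bot {N : Subgroup G} (hN : N.Normal) (h : ⁅N, N⁆ = ⊥) :
    N ≤ fitting G :=
  le_fitting hN ((isNilpotent_iff_lowerCentralSeries N).2 ⟨1, h⟩)

lemma mk'_fitting_eq_one_iff {g : G} : QuotientGroup.mk' (fitting G) g = 1 ↔ g ∈ fitting G := by
  rw [← MonoidHom.mem_ker, QuotientGroup.ker_mk']

lemma fitting_le_genFitting : fitting G ≤ genFitting G := fun g hg => by
  have : QuotientGroup.mk' (fitting G) g = 1 := mk'_fitting_eq_one_iff.2 hg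
  rw [genFitting, mem_comap, this]
  exact one_mem _

instance map_centralizer_fitting_normal :
    ((centralizer (fitting G : Set G)).map (QuotientGroup.mk' (fitting G))).Normal :=
  Normal.map inferInstance _ (QuotientGroup.mk'_surjective _)

instance genFitting_normal : (genFitting G).Normal := by
  unfold genFitting; infer_instance

lemma map_genFitting : (genFitting G).map (QuotientGroup.mk' (fitting G)) =
    (socle ((centralizer (fitting G : Set G)).map (QuotientGroup.mk' (fitting G)))).map
      (Subgroup.subtype _) :=
  map_comap_eq_self_of_surjective (QuotientGroup.mk'_surjective _) _

lemma exists_mul_eq_of_mem_genFitting {g : G} (hg : g ∈ genFitting G) :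
    ∃ f ∈ fitting G, ∃ c ∈ centralizer (fitting G : Set G), f * c = g := by
  obtain ⟨x, -, hx⟩ := hg
  obtain ⟨c, hc, hcx⟩ := x.2
  refine ⟨g * c⁻¹, ?_, c, hc, by simp⟩
  rw [← mk'_fitting_eq_one_iff, map_mul, map_inv, hcx, mul_inv_eq_one]
  exact hx.symm

lemma socle_map_genFitting [Finite G] :
    socle ((genFitting G).map (QuotientGroup.mk' (fitting G))) = ⊤ := by
  rw [map_genFitting]
  exact socle_eq_top_of_surjective (MonoidHom.subgroupMap_surjective _ _) socle_socle

/-- `fitting G` enters only as a join, so its nilpotency is not used: any two of its nilpotent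
normal generators commute modulo `Φ(F*(G))`. -/
lemma commutator_map_fitting_genFitting [Finite G] :
    ⁅((fitting G).subgroupOf (genFitting G)).map (QuotientGroup.mk' (frattini (genFitting G))),
      ((fitting G).subgroupOf (genFitting G)).map (QuotientGroup.mk' (frattini (genFitting G)))⁆
      = ⊥ := by
  let Q := genFitting G
  let ρ := QuotientGroup.mk' (frattini Q)
  have hρ : Function.Surjective ρ := QuotientGroup.mk'_surjective _
  have hab : ∀ N : Subgroup G, N.Normal → Group.IsNilpotent N →
      ⁅(N.subgroupOf Q).map ρ, (N.subgroupOf Q).map ρ⁆ = ⊥ := by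
    intro N hN hnil
    have hnil' : Group.IsNilpotent (N.subgroupOf Q) :=
      (Group.isNilpotent_congr
        (subgroupOfEquivOfLe ((le_fitting hN hnil).trans fitting_le_genFitting))).2 hnil
    rw [← map_commutator, Subgroup.map_eq_bot_iff, QuotientGroup.ker_mk']
    exact commutator_le_frattini_of_isNilpotent _ hnil'
  have hnorm : ∀ N : Subgroup G, N.Normal → ((N.subgroupOf Q).map ρ).Normal := fun N _ =>
    Normal.map inferInstance ρ hρ
  have hcomm : ∀ M N : Subgroup G, M.Normal → Group.IsNilpotent M → N.Normal →
      Group.IsNilpotent N → ⁅M, N⁆ ≤ (frattini Q).map Q.subtype := by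
    intro M N hM hMn hN hNn
    have := hnorm M hM
    have := hnorm N hN
    have h := commutator_eq_bot_of_frattini_eq_bot frattini_quotient_frattini
      (hab M hM hMn) (hab N hN hNn)
    rw [← map_commutator, Subgroup.map_eq_bot_iff, QuotientGroup.ker_mk'] at h
    have h' := map_mono (f := Q.subtype) h
    rwa [map_commutator, map_subgroupOf_eq_of_le ((le_fitting hM hMn).trans fitting_le_genFitting),
      map_subgroupOf_eq_of_le ((le_fitting hN hNn).trans fitting_le_genFitting)] at h'
  have hFF : ⁅fitting G, fitting G⁆ ≤ (frattini Q).map Q.subtype := by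
    have hR : ((frattini Q).map Q.subtype).Normal := inferInstance
    -- For fixed `B` the condition bounds `A` by one subgroup, so it passes to joins, in each
    -- argument in turn.
    have key : ∀ {A B : Subgroup G}, ⁅A, B⁆ ≤ (frattini Q).map Q.subtype ↔
        A ≤ (centralizer (B.map (QuotientGroup.mk' ((frattini Q).map Q.subtype)) :
          Set (G ⧸ (frattini Q).map Q.subtype))).comap (QuotientGroup.mk' _) := by
      intro A B
      rw [← map_le_iff_le_comap, ← commutator_eq_bot_iff_le_centralizer, ← map_commutator,
        Subgroup.map_eq_bot_iff, QuotientGroup.ker_mk']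
    rw [key]
    refine sSup_le fun M hM => key.1 ?_
    rw [commutator_comm, key]
    refine sSup_le fun N hN => key.1 (hcomm N M hN.1 hN.2 hM.1 hM.2)
  change ⁅((fitting G).subgroupOf Q).map ρ, ((fitting G).subgroupOf Q).map ρ⁆ = ⊥
  rw [← map_commutator, Subgroup.map_eq_bot_iff, QuotientGroup.ker_mk',
    ← map_le_map_iff_of_injective Q.subtype_injective, map_commutator,
    map_subgroupOf_eq_of_le fitting_le_genFitting]
  exact hFF

/-- Modulo `Φ(Q)`, the image `A` of `F(G)` is abelian, and central because `Q ≤ F(G)C_G(F(G))`. Its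
complement `M` is a quotient of `Q/F(G)`, hence its own socle; as `A` is central, that socle lies in
the socle of the whole group. -/
lemma tildeF_genFitting [Finite G] : tildeF (genFitting G) = ⊤ := by
  rw [tildeF_eq_top_iff]
  let Q := genFitting G
  let ρ := QuotientGroup.mk' (frattini Q)
  have hρ : Function.Surjective ρ := QuotientGroup.mk'_surjective _
  set A := ((fitting G).subgroupOf Q).map ρ with hAdef
  have hAn : A.Normal := Normal.map inferInstance ρ hρ
  have hab : ⁅A, A⁆ = ⊥ := commutator_map_fitting_genFitting
  have hab' := commutator_eq_bot_iff_le_centralizer.1 hab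
  obtain ⟨M, hsup, hinf⟩ := exists_complement_of_frattini_eq_bot frattini_quotient_frattini hab
  have hcen : ∀ x : Q ⧸ frattini Q, x ∈ centralizer (A : Set (Q ⧸ frattini Q)) := by
    intro x
    obtain ⟨q, rfl⟩ := hρ x
    obtain ⟨f, hf, c, hc, hq⟩ := exists_mul_eq_of_mem_genFitting q.2
    have hfQ : f ∈ Q := fitting_le_genFitting hf
    have hcQ : c ∈ Q := by
      rw [show c = f⁻¹ * q by rw [← hq, inv_mul_cancel_left]]
      exact mul_mem (inv_mem hfQ) q.2
    have hq' : q = ⟨f, hfQ⟩ * ⟨c, hcQ⟩ := Subtype.ext hq.symm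
    rw [hq', map_mul]
    refine mul_mem (hab' (mem_map_of_mem ρ hf)) ?_
    rintro _ ⟨y, hy, rfl⟩
    rw [← map_mul, ← map_mul]
    exact congrArg ρ (Subtype.ext (hc y hy))
  obtain ⟨p, hp, hpker, hpA⟩ := exists_projection A M hsup hinf
  have hM : socle M = ⊤ := by
    refine socle_eq_top_of_ker_le (f := (QuotientGroup.mk' (fitting G)).subgroupMap Q)
      (g := p.comp ρ) (MonoidHom.subgroupMap_surjective _ _) (hp.comp hρ) ?_ socle_map_genFitting
    intro x hx
    have hx' : (x : G) ∈ fitting G := mk'_fitting_eq_one_iff.1 (congrArg Subtype.val hx)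
    have : ρ x ∈ p.ker := hpker ▸ mem_map_of_mem ρ hx'
    exact this
  have hMs : M ≤ socle (Q ⧸ frattini Q) := by
    have h := map_socle_le_of_centralizer (M := M) fun x => by
      obtain ⟨a, ha, m, hm, h⟩ := mem_sup_of_normal_left.1 (hsup ▸ mem_top x : x ∈ A ⊔ M)
      exact ⟨a, fun y _ => (hcen y a ha).symm, m, hm, h⟩
    rwa [hM, ← MonoidHom.range_eq_map, range_subtype] at h
  rw [eq_top_iff]
  exact hsup ▸ sup_le (le_socle_of_frattini_eq_bot frattini_quotient_frattini hab) hMs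

lemma genFitting_le_tildeFLim [Finite G] : genFitting G ≤ tildeFLim G :=
  le_tildeFLim tildeF_genFitting

/-- Otherwise the image of `C` modulo `F(G)` contains a minimal normal subgroup of `X`, which lies
in `F*(G)/F(G)`; but `C ⊓ genFitting G` is abelian and normal, so it vanishes modulo `F(G)`. -/
lemma centralizer_genFitting_le_fitting [Finite G] :
    centralizer (genFitting G : Set G) ≤ fitting G := by
  let π := QuotientGroup.mk' (fitting G)
  set C := centralizer (genFitting G : Set G) with hCdef
  set X := (centralizer (fitting G : Set G)).map π
  have hCX : C.map π ≤ X := map_mono (centralizer_le fitting_le_genFitting)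
  have hCn : (C.map π).Normal := Normal.map inferInstance π (QuotientGroup.mk'_surjective _)
  have hCQ : C ⊓ genFitting G ≤ fitting G := by
    refine le_fitting_of_commutator_eq_bot inferInstance
      (commutator_eq_bot_iff_le_centralizer.2 ?_)
    exact inf_le_left.trans (centralizer_le inf_le_right)
  have hb : (C.map π).subgroupOf X = ⊥ := by
    by_contra hne
    obtain ⟨K, hK, hKC⟩ := exists_isMinimalNormal_le inferInstance hne
    refine hK.prop.2 ((eq_bot_iff_forall _).2 fun k hk => ?_)
    obtain ⟨c, hc, hck⟩ := hKC hk
    have hcQ : c ∈ genFitting G := ⟨k, hK.le_socle hk, hck.symm⟩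
    refine Subtype.ext (hck.symm.trans ?_)
    exact mk'_fitting_eq_one_iff.2 (hCQ ⟨hc, hcQ⟩)
  rw [subgroupOf_eq_bot, disjoint_iff, inf_eq_left.2 hCX, Subgroup.map_eq_bot_iff,
    QuotientGroup.ker_mk'] at hb
  exact hb

/-- For `N` nilpotent and normal, `T ⊓ N` is central in `T`, so the three subgroups lemma applies to
`T, T, N`. -/
lemma commutator_le_centralizer_fitting {T : Subgroup G} [Finite T] [T.Normal]
    (hT : socle T = ⊤) : ⁅T, T⁆ ≤ centralizer (fitting G : Set G) := by
  rw [le_centralizer_iff]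
  refine sSup_le fun N ⟨hN, hnil⟩ => ?_
  rw [← le_centralizer_iff, ← commutator_eq_bot_iff_le_centralizer]
  have hTN : T ⊓ N ≤ centralizer (T : Set G) := by
    refine le_centralizer_of_isNilpotent hT inf_le_left
      (fun e _ d hd => (inferInstance : (T ⊓ N).Normal).conj_mem d hd e) ?_
    exact (Group.isNilpotent_congr (subgroupOfEquivOfLe (inf_le_right : T ⊓ N ≤ N))).1 inferInstance
  have h1 : ⁅⁅T, N⁆, T⁆ = ⊥ :=
    commutator_eq_bot_iff_le_centralizer.2 ((commutator_le_inf T N).trans hTN)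
  have h2 : ⁅⁅N, T⁆, T⁆ = ⊥ := by rwa [commutator_comm N T]
  exact commutator_commutator_eq_bot_of_rotate h1 h2

lemma le_genFitting [Finite G] {T : Subgroup G} [T.Normal] (hT : socle T = ⊤) :
    T ≤ genFitting G := by
  let π := QuotientGroup.mk' (fitting G)
  have hπ : Function.Surjective π := QuotientGroup.mk'_surjective _
  have hTn : ∀ D : Subgroup G, D.Normal → ∀ e ∈ T, ∀ d ∈ D, e * d * e⁻¹ ∈ D :=
    fun D hD e _ d hd => hD.conj_mem d hd e
  have hcenF : T ⊓ centralizer (T : Set G) ≤ fitting G :=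
    le_fitting_of_commutator_eq_bot inferInstance
      (commutator_eq_bot_iff_le_centralizer.2 (inf_le_right.trans (centralizer_le inf_le_left)))
  set X := (centralizer (fitting G : Set G)).map π with hX
  -- `T` is `⁅T, T⁆` times a complement that is abelian, hence central in `T`, hence inside `F(G)`.
  have hTX : T.map π ≤ X := by
    obtain ⟨C, hCT, hCn, hdec, hinf, -⟩ := exists_complement_of_socle_eq_top hT
      (commutator_le_self T) (hTn ⁅T, T⁆ inferInstance)
    have hCC : ⁅C, C⁆ = ⊥ := by
      rw [eq_bot_iff, ← hinf]
      exact le_inf (commutator_mono hCT hCT) (commutator_le_self C)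
    have hCF : C ≤ fitting G :=
      (le_inf hCT (le_centralizer_of_commutator_eq_bot hT hCT hCn hCC)).trans hcenF
    rintro _ ⟨t, ht, rfl⟩
    obtain ⟨d, hd, c, hc, rfl⟩ := hdec t ht
    refine ⟨d, commutator_le_centralizer_fitting hT hd, ?_⟩
    rw [map_mul, show π c = 1 from mk'_fitting_eq_one_iff.2 (hCF hc), mul_one]
  have hTπ : (T.map π).Normal := Normal.map inferInstance π hπ
  have hsoc : socle ((T.map π).subgroupOf X) = ⊤ := by
    refine socle_eq_top_of_surjective (f := (subgroupOfEquivOfLe hTX).symm.toMonoidHom)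
      (subgroupOfEquivOfLe hTX).symm.surjective ?_
    exact socle_eq_top_of_surjective (π.subgroupMap_surjective T) hT
  have hle : (T.map π).subgroupOf X ≤ socle X := by
    refine le_socle_of_socle_eq_top hsoc fun K hK hKT hKK => ?_
    -- Lift `K` to the complement of `T ⊓ fitting G` in `T`: the lift is abelian and normal in `T`,
    -- so central in `T` and inside `F(G)`.
    suffices h : K = ⊥ by rw [h]; exact bot_le
    obtain ⟨C, hCT, hCn, hdec, hinf, -⟩ := exists_complement_of_socle_eq_top hT
      (inf_le_left : T ⊓ fitting G ≤ T) (hTn _ inferInstance)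
    have hP : C ⊓ (K.map X.subtype).comap π ≤ T := inf_le_left.trans hCT
    have hPn : ∀ e ∈ T, ∀ d ∈ C ⊓ (K.map X.subtype).comap π,
        e * d * e⁻¹ ∈ C ⊓ (K.map X.subtype).comap π := by
      rintro e he d ⟨hdC, k, hk, hkd⟩
      refine ⟨hCn e he d hdC, ?_⟩
      have heX : π e ∈ X := hTX (mem_map_of_mem π he)
      refine ⟨⟨π e, heX⟩ * k * ⟨π e, heX⟩⁻¹, hK.conj_mem k hk _, ?_⟩
      rw [map_mul, map_mul, map_mul, map_mul, hkd]
      rfl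
    have hPP : ⁅C ⊓ (K.map X.subtype).comap π, C ⊓ (K.map X.subtype).comap π⁆ = ⊥ := by
      rw [eq_bot_iff, ← hinf]
      refine le_inf (le_inf ((commutator_le_self _).trans hP) ?_)
        ((commutator_le_self _).trans inf_le_left)
      refine (commutator_mono inf_le_right inf_le_right).trans ?_
      suffices h : ⁅(K.map X.subtype).comap π, (K.map X.subtype).comap π⁆.map π = ⊥ by
        rwa [Subgroup.map_eq_bot_iff, QuotientGroup.ker_mk'] at h
      rw [map_commutator, eq_bot_iff]
      refine (commutator_mono (map_comap_le _ _) (map_comap_le _ _)).trans ?_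
      rw [← map_commutator, hKK, Subgroup.map_bot]
    have hPF := (le_inf hP (le_centralizer_of_commutator_eq_bot hT hP hPn hPP)).trans hcenF
    refine (eq_bot_iff_forall _).2 fun k hk => ?_
    obtain ⟨t, ht, htk⟩ := hKT hk
    obtain ⟨a, ha, c, hc, rfl⟩ := hdec t ht
    have hac : π (a * c) = π c := by
      rw [map_mul, show π a = 1 from mk'_fitting_eq_one_iff.2 (mem_inf.1 ha).2, one_mul]
    rw [hac] at htk
    have hcF : c ∈ fitting G := hPF ⟨hc, k, hk, htk.symm⟩
    exact Subtype.ext (htk.symm.trans (mk'_fitting_eq_one_iff.2 hcF))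
  intro t ht
  have htT : π t ∈ T.map π := mem_map_of_mem π ht
  exact ⟨⟨π t, hTX htT⟩, hle htT, rfl⟩

lemma tildeFLim_eq_genFitting [Finite G] (h : frattini (tildeFLim G) = ⊥) :
    tildeFLim G = genFitting G := by
  refine le_antisymm (le_genFitting ?_) genFitting_le_tildeFLim
  refine socle_eq_top_of_ker_le (f := QuotientGroup.mk' (frattini (tildeFLim G)))
    (g := MonoidHom.id _) (QuotientGroup.mk'_surjective _) Function.surjective_id ?_
    (tildeF_eq_top_iff.1 tildeF_tildeFLim)
  rw [QuotientGroup.ker_mk', h]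
  exact bot_le

end QuasinilpotentRadical

end GenFitting

theorem corollary3p4 (G : Type*) [Group G] [Finite G] :
    GenFitting.IsQuasinilpotent
        (GenFitting.tildeFLim G ⧸ frattini (GenFitting.tildeFLim G)) ∧
    (GenFitting.genFitting G ≤ GenFitting.tildeFLim G ∧
      GenFitting.tildeFLim G ≤ GenFitting.tildeF G) ∧
    (frattini (GenFitting.tildeFLim G) = ⊥ →
      GenFitting.tildeFLim G = GenFitting.genFitting G) ∧
    Subgroup.centralizer (GenFitting.tildeFLim G : Set G) ≤ GenFitting.fitting G ∧
    (∀ (N : Subgroup G) [N.Normal],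
      (GenFitting.tildeFLim N).map N.subtype ≤ GenFitting.tildeFLim G) ∧
    (∀ (N : Subgroup G) [N.Normal],
      (GenFitting.tildeFLim G).map (QuotientGroup.mk' N) ≤ GenFitting.tildeFLim (G ⧸ N)) ∧
    (∀ (N H : Subgroup G) [N.Normal] [H.Normal],
      GenFitting.IsInternalDirectProduct ⊤ N H →
      GenFitting.IsInternalDirectProduct (GenFitting.tildeFLim G)
        ((GenFitting.tildeFLim H).map H.subtype) ((GenFitting.tildeFLim N).map N.subtype)) := by
  refine ⟨?_, ⟨GenFitting.genFitting_le_tildeFLim, GenFitting.tildeFLim_le_tildeF⟩,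
    GenFitting.tildeFLim_eq_genFitting, ?_, fun N _ => GenFitting.map_subtype_tildeFLim_le N,
    fun N _ => GenFitting.map_tildeFLim_le (QuotientGroup.mk'_surjective N),
    fun N H _ _ => GenFitting.tildeFLim_internalDirectProduct N H⟩
  · exact GenFitting.isQuasinilpotent_of_socle_eq_top
      (GenFitting.tildeF_eq_top_iff.1 GenFitting.tildeF_tildeFLim)
  · exact (Subgroup.centralizer_le GenFitting.genFitting_le_tildeFLim).trans
      GenFitting.centralizer_genFitting_le_fitting
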